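/- Let $\mathbb{D}$ be the open unit disc and $\mathbb{T}$ the unit circle. A closed set $E\subset\mathbb{T}$ of Lebesgue measure zero is a Beurling–Carleson set if $\sum_k |I_k|\log(1/|I_k|)<\infty$, where $(I_k)_k$ are the maximal open arcs of $\mathbb{T}\setminus E$ and $|I_k|$ denotes arc length. For a finite positive Borel measure $\nu$ on $\mathbb{T}$, singular with respect to Lebesgue measure, let $$S_\nu(z)=\exp\Big(-\int_{\mathbb{T}}\frac{\zeta+z}{\zeta-z}\,d\nu(\zeta)\Big),\qquad z\in\mathbb{D},$$ be the associated singular inner function. Let $\mathcal{A}^\infty=\bigcap_{n\ge 1}\mathcal{A}^n$, where $\mathcal{A}^n$ is the class of analytic functions on $\mathbb{D}$ whose derivative of order $n$ extends continuously to $\overline{\mathbb{D}}$. The boundary function of a function on $\mathbb{D}$ is its nontangential limit, defined almost everywhere on $\mathbb{T}$, and functions that agree almost everywhere are identified. Proposition. Let $\nu$ be a finite positive Borel measure on $\mathbb{T}$ supported on a Beurling–Carleson set $E$ (that is, $\nu(\mathbb{T}\setminus E)=0$; in particular $\nu$ is singular). Then there exists a sequence $(H_n)_n$ of functions in $\mathcal{A}^\infty$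 such that (i) for every $n$, the boundary function of $S_\nu\overline{H_n}$ exists and is of class $C^\infty(\mathbb{T})$; (ii) $\lim_{n\to\infty}H_n(\zeta)=1$ for Lebesgue almost every $\zeta\in\mathbb{T}$, where $H_n(\zeta)$ denotes the boundary value of $H_n$; (iii) $\sup_n\|H_n\|_\infty<\infty$, where $\|H_n\|_\infty=\sup_{z\in\mathbb{D}}|H_n(z)|$. -/

import Mathlib

open MeasureTheory Filter Topology

noncomputable section

namespace ModelSpace

instance : MeasurableSpace Circle := borel Circle

instance : BorelSpace Circle := ⟨rfl⟩

/-- Arc length measure on the unit circle (total mass `2π`). -/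
def arcLength : Measure Circle :=
  (volume.restrict (Set.Ioc (-Real.pi) Real.pi)).map Circle.exp

/-- The maximal open arcs complementary to `E`: the connected components of `𝕋 \ E`. -/
def complementaryArcs (E : Set Circle) : Set (Set Circle) :=
  {I | ∃ ζ ∈ Eᶜ, I = connectedComponentIn Eᶜ ζ}

/-- Beurling–Carleson sets: closed null sets with `∑ |I| log (1 / |I|) < ∞`, the sum being
over the complementary arcs. At most finitely many terms are negative. -/
structure IsBeurlingCarleson (E : Set Circle) : Prop where
  isClosed : IsClosed E
  null : arcLength E = 0
  entropy : Summable fun (I : complementaryArcs E) ↦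
    arcLength.real (I : Set Circle) * Real.log (1 / arcLength.real (I : Set Circle))

/-- The singular inner function `S_ν(z) = exp (-∫ (ζ + z) / (ζ - z) dν(ζ))`, `z ∈ 𝔻`. -/
def singularInner (ν : Measure Circle) (z : ℂ) : ℂ :=
  Complex.exp (-∫ ζ : Circle, ((ζ : ℂ) + z) / ((ζ : ℂ) - z) ∂ν)

/-- The class `𝒜ⁿ`: `f` is analytic in `𝔻` and `f⁽ⁿ⁾` extends continuously to the closed disc. -/
def MemA (n : ℕ) (f : ℂ → ℂ) : Prop :=
  DifferentiableOn ℂ f (Metric.ball 0 1) ∧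
    ∃ F : ℂ → ℂ, ContinuousOn F (Metric.closedBall 0 1) ∧
      Set.EqOn F (iteratedDeriv n f) (Metric.ball 0 1)

/-- The class `𝒜^∞ = ⋂_{n ≥ 1} 𝒜ⁿ`. -/
def MemAInfty (f : ℂ → ℂ) : Prop := ∀ n : ℕ, 1 ≤ n → MemA n f

/-- The Stolz (nontangential approach) region in `𝔻` with vertex `ζ` and aperture `M`. -/
def stolzRegion (ζ : Circle) (M : ℝ) : Set ℂ :=
  {z | ‖z‖ < 1 ∧ ‖z - ζ‖ < M * (1 - ‖z‖)}

/-- `u` is the boundary function of the function `f` on `𝔻`: at almost every `ζ ∈ 𝕋`, the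
nontangential limit of `f` exists and equals `u ζ`. It determines `u` almost everywhere. -/
def HasBoundaryFunction (f : ℂ → ℂ) (u : Circle → ℂ) : Prop :=
  ∀ᵐ ζ : Circle ∂arcLength, ∀ M : ℝ, 1 < M → Tendsto f (𝓝[stolzRegion ζ M] (ζ : ℂ)) (𝓝 (u ζ))

/-- `u` is of class `C^∞(𝕋)`: infinitely differentiable as a function of the angle. -/
def SmoothOnCircle (u : Circle → ℂ) : Prop :=
  ContDiff ℝ ((⊤ : ℕ∞) : WithTop ℕ∞) fun t : ℝ ↦ u (Circle.exp t)

end ModelSpace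

end

/-! Write d(z) for the distance from z to E. Cutting the circle at a point of E turns the
complementary arcs into intervals, on each of which the integral of log(2/d) is at most a constant
times |I| plus |I| log(1/|I|). So the Beurling–Carleson condition makes log(2/d) integrable
(`lintegral_log_distTo_lt_top`). An integrable function has an integrable majorant g that eventually
exceeds each of its multiples (`exists_superlinear_majorant`). Put μ = g dm, with m arc length.

Let G be the Herglotz integral of μ with the pole at ζ pushed out to (1 + d(ζ))ζ. Then G is analytic
near every point of the closed disc off E, Re G ≥ 0, and Re G ≥ N log(2/d) - C_N for every N
(`log_le_re_herglotz_pole`). The functions are H_n = exp(-G/(n+1)): they are bounded by 1, tend to 1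
off E, and still decay faster than every power of d, because the growth of Re G is superlogarithmic.

Derivatives are controlled by Cauchy estimates on discs of radius comparable to d², where G and the
exponent of S_ν oscillate by a bounded amount. A k-th derivative costs d^(-2k), which the decay
absorbs, so H_n is smooth up to the boundary. On the circle off E, |S_ν| = 1, and S_ν times the
conjugate of H_n is the restriction to real angles of a holomorphic function of the angle, the
second factor being reflected in the real axis. The same estimates show that it is flat at E, hence
smooth once extended by zero. -/

namespace ModelSpace

/-! ### Herglotz integrals with general poles -/

/-- The Herglotz-type integral `∫ (w ζ + z) / (w ζ - z) dμ(ζ)` with poles at the points `w ζ`. -/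
noncomputable def herglotz (μ : Measure Circle) (w : Circle → ℂ) (z : ℂ) : ℂ :=
  ∫ ζ, (w ζ + z) / (w ζ - z) ∂μ

section Herglotz

variable {μ : Measure Circle} [IsFiniteMeasure μ] {w : Circle → ℂ}

lemma integrable_herglotz_kernel (hw : Measurable w) (hw3 : ∀ᵐ ζ ∂μ, ‖w ζ‖ ≤ 3) {z : ℂ} {m : ℝ}
    (hm : 0 < m) (hz : ∀ᵐ ζ ∂μ, m ≤ ‖w ζ - z‖) :
    Integrable (fun ζ ↦ (w ζ + z) / (w ζ - z)) μ := by
  refine Integrable.of_bound (C := (3 + ‖z‖) / m) ?_ ?_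
  · exact ((hw.add_const z).div (hw.sub_const z)).aestronglyMeasurable
  · filter_upwards [hw3, hz] with ζ h1 h2
    rw [norm_div]
    gcongr
    exact (norm_add_le _ _).trans (by gcongr)

/-- The difference of the kernels is 2w(z' - z) / ((w - z)(w - z')), and |w| ≤ 3 gives the factor 6.
-/
lemma norm_herglotz_sub_le (hw : Measurable w) (hw3 : ∀ᵐ ζ ∂μ, ‖w ζ‖ ≤ 3) {z z' : ℂ} {a b : ℝ}
    (ha : 0 < a) (hb : 0 < b) (hz : ∀ᵐ ζ ∂μ, a ≤ ‖w ζ - z‖) (hz' : ∀ᵐ ζ ∂μ, b ≤ ‖w ζ - z'‖) :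
    ‖herglotz μ w z' - herglotz μ w z‖ ≤ 6 / (a * b) * ‖z' - z‖ * μ.real Set.univ := by
  rw [herglotz, herglotz, ← integral_sub (integrable_herglotz_kernel hw hw3 hb hz')
    (integrable_herglotz_kernel hw hw3 ha hz)]
  refine norm_integral_le_of_norm_le_const ?_
  filter_upwards [hw3, hz, hz'] with ζ h1 h2 h3
  have e1 : w ζ - z ≠ 0 := norm_pos_iff.1 (ha.trans_le h2)
  have e2 : w ζ - z' ≠ 0 := norm_pos_iff.1 (hb.trans_le h3)
  have : (w ζ + z') / (w ζ - z') - (w ζ + z) / (w ζ - z)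
      = (2 * w ζ) * (z' - z) / ((w ζ - z) * (w ζ - z')) := by
    field_simp
    ring
  rw [this, norm_div, norm_mul, norm_mul, norm_mul, Complex.norm_ofNat, div_mul_eq_mul_div]
  gcongr
  linarith

lemma differentiableAt_herglotz (hw : Measurable w) (hw3 : ∀ᵐ ζ ∂μ, ‖w ζ‖ ≤ 3) {z : ℂ} {m : ℝ}
    (hm : 0 < m) (hz : ∀ᵐ ζ ∂μ, m ≤ ‖w ζ - z‖) : DifferentiableAt ℂ (herglotz μ w) z := by
  have key : ∀ᵐ ζ ∂μ, ∀ x ∈ Metric.ball z (m / 2), m / 2 ≤ ‖w ζ - x‖ := by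
    filter_upwards [hz] with ζ h x hx
    have h1 : ‖w ζ - z‖ ≤ ‖w ζ - x‖ + ‖x - z‖ := norm_sub_le_norm_sub_add_norm_sub _ _ _
    rw [mem_ball_iff_norm] at hx
    linarith
  refine (hasDerivAt_integral_of_dominated_loc_of_deriv_le
    (F := fun x ζ ↦ (w ζ + x) / (w ζ - x)) (F' := fun x ζ ↦ 2 * w ζ / (w ζ - x) ^ 2)
    (bound := fun _ ↦ 6 / (m / 2) ^ 2)
    (Metric.ball_mem_nhds z (half_pos hm)) (Eventually.of_forall fun x ↦ ?_)
    (integrable_herglotz_kernel hw hw3 hm hz) ?_ ?_ (integrable_const _) ?_).2.differentiableAt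
  · exact ((hw.add_const x).div (hw.sub_const x)).aestronglyMeasurable
  · exact ((hw.const_mul 2).div ((hw.sub_const z).pow_const 2)).aestronglyMeasurable
  · filter_upwards [hw3, key] with ζ h1 h2 x hx
    have := h2 x hx
    rw [norm_div, norm_mul, norm_pow, Complex.norm_ofNat]
    gcongr
    linarith
  · filter_upwards [key] with ζ h2 x hx
    have e : w ζ - x ≠ 0 := norm_pos_iff.1 ((half_pos hm).trans_le (h2 x hx))
    have := ((hasDerivAt_id x).const_add (w ζ)).div ((hasDerivAt_id x).const_sub (w ζ)) e
    refine this.congr_deriv ?_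
    simp only [id]
    ring

lemma re_herglotz (hw : Measurable w) (hw3 : ∀ᵐ ζ ∂μ, ‖w ζ‖ ≤ 3) {z : ℂ} {m : ℝ}
    (hm : 0 < m) (hz : ∀ᵐ ζ ∂μ, m ≤ ‖w ζ - z‖) :
    (herglotz μ w z).re = ∫ ζ, (‖w ζ‖ ^ 2 - ‖z‖ ^ 2) / ‖w ζ - z‖ ^ 2 ∂μ := by
  have h := integral_re (integrable_herglotz_kernel hw hw3 hm hz)
  rw [herglotz]
  simp only [RCLike.re_to_complex] at h
  rw [← h]
  refine integral_congr_ae (Eventually.of_forall fun ζ ↦ ?_)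
  simp only [Complex.div_re, ← Complex.normSq_eq_norm_sq]
  rw [← add_div]
  congr 1
  simp [Complex.normSq_apply]
  ring

end Herglotz

/-! ### Cauchy estimates and flat functions -/

/-- Cauchy estimate for `exp (-Q)` on a disc where `Q` oscillates by at most `1`. -/
lemma norm_iteratedDeriv_exp_neg_le {Q : ℂ → ℂ} {z : ℂ} {r : ℝ} (hr : 0 < r)
    (hQ : ∀ x ∈ Metric.closedBall z r, DifferentiableAt ℂ Q x)
    (hosc : ∀ x ∈ Metric.closedBall z r, ‖Q x - Q z‖ ≤ 1) (k : ℕ) :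
    ‖iteratedDeriv k (fun x ↦ Complex.exp (-Q x)) z‖
      ≤ k.factorial * Real.exp (1 - (Q z).re) / r ^ k := by
  refine Complex.norm_iteratedDeriv_le_of_forall_mem_sphere_norm_le k hr ?_ ?_
  · refine DifferentiableOn.diffContOnCl_ball (U := Metric.closedBall z r) (fun x hx ↦ ?_) le_rfl
    exact ((hQ x hx).neg.cexp).differentiableWithinAt
  · intro x hx
    rw [Complex.norm_exp]
    have h1 := (Complex.abs_re_le_norm _).trans (hosc x (Metric.sphere_subset_closedBall hx))
    rw [Complex.sub_re, abs_le] at h1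
    gcongr
    rw [Complex.neg_re]
    linarith

/-- A function which vanishes on `Z` and is smooth off `Z`, with all derivatives
`O(dist(·, Z)²)`, is smooth. -/
lemma contDiff_of_flat {f : ℝ → ℂ} {Z : Set ℝ} (hfZ : ∀ t ∈ Z, f t = 0)
    (hf : ∀ t ∉ Z, ∀ k : ℕ, DifferentiableAt ℝ (iteratedDeriv k f) t)
    (hb : ∀ k : ℕ, ∃ C : ℝ, ∀ t ∉ Z, ∀ s ∈ Z, ‖iteratedDeriv k f t‖ ≤ C * |t - s| ^ 2) :
    ContDiff ℝ ((⊤ : ℕ∞) : WithTop ℕ∞) f := by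
  have step : ∀ k : ℕ, (∀ t ∈ Z, iteratedDeriv k f t = 0) →
      ∀ t ∈ Z, HasDerivAt (iteratedDeriv k f) 0 t := by
    intro k hk t ht
    obtain ⟨C, hC⟩ := hb k
    -- Any exponent above 1 would do: it forces the next derivative to vanish at t.
    have h : (iteratedDeriv k f) =O[𝓝 t] fun x ↦ ‖x - t‖ ^ 2 := by
      refine Asymptotics.IsBigO.of_bound |C| (Eventually.of_forall fun x ↦ ?_)
      rw [norm_pow, norm_norm, Real.norm_eq_abs]
      by_cases hx : x ∈ Z
      · rw [hk x hx, norm_zero]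
        positivity
      · exact (hC x hx t ht).trans (by gcongr; exact le_abs_self C)
    simpa using (h.hasFDerivAt one_lt_two).hasDerivAt
  have zero : ∀ k : ℕ, ∀ t ∈ Z, iteratedDeriv k f t = 0 := by
    intro k
    induction k with
    | zero => simpa using hfZ
    | succ k ih =>
      intro t ht
      rw [iteratedDeriv_succ]
      exact (step k ih t ht).deriv
  refine contDiff_of_differentiable_iteratedDeriv fun k _ t ↦ ?_
  by_cases ht : t ∈ Z
  · exact (step k (zero k) t ht).differentiableAt
  · exact hf t ht k

/-! ### Arc length in angular coordinates -/

/-- The period may start anywhere, so the circle can be cut at a point of E. -/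
lemma arcLength_eq_map (s : ℝ) :
    arcLength = (volume.restrict (Set.Ioc s (s + 2 * Real.pi))).map Circle.exp := by
  have : Fact (0 < 2 * Real.pi) := ⟨Real.two_pi_pos⟩
  have key (t : ℝ) : (volume.restrict (Set.Ioc t (t + 2 * Real.pi))).map Circle.exp
      = (volume : Measure (AddCircle (2 * Real.pi))).map AddCircle.homeomorphCircle' := by
    rw [← (AddCircle.measurePreserving_mk (2 * Real.pi) t).map_eq,
      Measure.map_map AddCircle.homeomorphCircle'.continuous.measurable
        (AddCircle.measurePreserving_mk (2 * Real.pi) t).measurable]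
    rfl
  rw [arcLength, key s, ← key (-Real.pi)]
  congr 3
  ring

instance : IsFiniteMeasure arcLength := by
  unfold arcLength
  infer_instance

lemma arcLength_apply (s : ℝ) {A : Set Circle} (hA : MeasurableSet A) :
    arcLength A = volume (Circle.exp ⁻¹' A ∩ Set.Ioc s (s + 2 * Real.pi)) := by
  rw [arcLength_eq_map s, Measure.map_apply Circle.exp.continuous.measurable hA,
    Measure.restrict_apply (Circle.exp.continuous.measurable hA)]

lemma norm_exp_sub_exp (s t : ℝ) :
    ‖(Circle.exp s : ℂ) - Circle.exp t‖ = ‖2 * Real.sin ((s - t) / 2)‖ := by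
  rw [← Complex.norm_exp_I_mul_ofReal_sub_one]
  have : (Circle.exp s : ℂ) - Circle.exp t
      = Circle.exp t * (Complex.exp (Complex.I * (s - t : ℝ)) - 1) := by
    rw [mul_sub, mul_one, Circle.coe_exp, Circle.coe_exp, ← Complex.exp_add]
    congr 2
    push_cast
    ring
  rw [this, norm_mul, Circle.norm_coe, one_mul]

lemma two_mul_le_arcLength {h : ℝ} (h1 : h ≤ 1) (ξ : Circle) :
    ENNReal.ofReal (2 * h) ≤ arcLength {ζ : Circle | ‖(ζ : ℂ) - ξ‖ ≤ h} := by
  have hpi := Real.pi_gt_three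
  obtain ⟨θ, rfl⟩ := Circle.exp_surjective ξ
  rw [arcLength_apply (θ - Real.pi) (by measurability)]
  calc ENNReal.ofReal (2 * h) = volume (Set.Icc (θ - h) (θ + h)) := by
        rw [Real.volume_Icc]; congr 1; ring
    _ ≤ _ := measure_mono fun t ht ↦ ?_
  refine ⟨?_, by linarith [ht.1], by linarith [ht.2]⟩
  simp only [Set.mem_preimage, Set.mem_ofPred_eq]
  rw [norm_exp_sub_exp, Real.norm_eq_abs, abs_mul, abs_two]
  have : |Real.sin ((t - θ) / 2)| ≤ |(t - θ) / 2| := Real.abs_sin_le_abs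
  rw [abs_div, abs_two] at this
  have : |t - θ| ≤ h := abs_le.2 ⟨by linarith [ht.1], by linarith [ht.2]⟩
  linarith

/-! ### Distance to E and integrability of its logarithm -/

/-- The Euclidean distance from `z` to a subset `E` of the unit circle. -/
noncomputable def distTo (E : Set Circle) (z : ℂ) : ℝ := Metric.infDist z (((↑) : Circle → ℂ) '' E)

lemma continuous_distTo (E : Set Circle) : Continuous (distTo E) := Metric.continuous_infDist_pt _

lemma distTo_nonneg (E : Set Circle) (z : ℂ) : 0 ≤ distTo E z := Metric.infDist_nonneg

lemma distTo_le {E : Set Circle} {e : Circle} (he : e ∈ E) (z : ℂ) : distTo E z ≤ ‖z - e‖ := by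
  rw [← dist_eq_norm]
  exact Metric.infDist_le_dist_of_mem (Set.mem_image_of_mem _ he)

lemma distTo_le_add (E : Set Circle) (x y : ℂ) : distTo E x ≤ distTo E y + ‖x - y‖ := by
  rw [← dist_eq_norm]
  exact Metric.infDist_le_infDist_add_dist

lemma distTo_le_two {E : Set Circle} (hne : E.Nonempty) {z : ℂ} (hz : ‖z‖ ≤ 1) :
    distTo E z ≤ 2 := by
  obtain ⟨e, he⟩ := hne
  refine (distTo_le he z).trans ((norm_sub_le _ _).trans ?_)
  rw [Circle.norm_coe]
  linarith

lemma distTo_pos_iff {E : Set Circle} (hE : IsClosed E) (hne : E.Nonempty) (z : ℂ) :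
    0 < distTo E z ↔ z ∉ ((↑) : Circle → ℂ) '' E := by
  have : IsClosed (((↑) : Circle → ℂ) '' E) := (hE.isCompact.image (by fun_prop)).isClosed
  exact (this.notMem_iff_infDist_pos (hne.image _)).symm

lemma distTo_coe_pos_iff {E : Set Circle} (hE : IsClosed E) (hne : E.Nonempty) (ζ : Circle) :
    0 < distTo E ζ ↔ ζ ∉ E := by
  rw [distTo_pos_iff hE hne]
  exact not_congr ⟨fun ⟨e, he, h⟩ ↦ Circle.coe_injective h ▸ he, fun h ↦ ⟨_, h, rfl⟩⟩

/-- A point of E has an angle t + x with |x| ≤ π lying outside (a, b), so |x| is at least the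
minimum. Jordan's inequality for the sine compares chord and angle. -/
lemma mul_min_le_distTo {E : Set Circle} (hne : E.Nonempty) {a b : ℝ}
    (hab : ∀ s ∈ Set.Ioo a b, Circle.exp s ∉ E) (t : ℝ) :
    2 / Real.pi * min (t - a) (b - t) ≤ distTo E (Circle.exp t) := by
  refine (Metric.le_infDist (hne.image _)).2 ?_
  rintro _ ⟨e, he, rfl⟩
  set x := Complex.arg (e * (Circle.exp t)⁻¹ : Circle) with hx
  have hexp : Circle.exp (t + x) = e := by
    rw [Circle.exp_add, hx, Circle.exp_arg, mul_comm, inv_mul_cancel_right]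
  have hx1 : |x| ≤ Real.pi := Complex.abs_arg_le_pi _
  have hout : t + x ∉ Set.Ioo a b := fun h ↦ hab _ h (hexp ▸ he)
  have hmin : min (t - a) (b - t) ≤ |x| := by
    by_contra! hcon
    rw [lt_min_iff] at hcon
    exact hout ⟨by linarith [neg_abs_le x, hcon.1], by linarith [le_abs_self x, hcon.2]⟩
  rw [dist_eq_norm, ← hexp, norm_exp_sub_exp, Real.norm_eq_abs, abs_mul, abs_two]
  have h2 : |(t - (t + x)) / 2| ≤ Real.pi / 2 := by
    rw [show (t - (t + x)) / 2 = -(x / 2) by ring, abs_neg, abs_div, abs_two]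
    linarith
  have h3 := Real.mul_abs_le_abs_sin h2
  have h4 : |(t - (t + x)) / 2| = |x| / 2 := by
    rw [show (t - (t + x)) / 2 = -(x / 2) by ring, abs_neg, abs_div, abs_two]
  rw [h4] at h3
  have : 2 / Real.pi * min (t - a) (b - t) ≤ 2 / Real.pi * |x| := by gcongr
  linarith

/-- In an angular coordinate based at a point of `E`, the complementary arcs are intervals. -/
lemma exists_Ioo_of_mem_complementaryArcs {E : Set Circle} (hE : IsClosed E) {s₀ : ℝ}
    (hs : Circle.exp s₀ ∈ E) {I : Set Circle} (hI : I ∈ complementaryArcs E) :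
    ∃ a b : ℝ, a < b ∧
      Circle.exp ⁻¹' I ∩ Set.Ioc s₀ (s₀ + 2 * Real.pi) = Set.Ioo a b := by
  obtain ⟨ξ, hξ, rfl⟩ := hI
  set I := connectedComponentIn Eᶜ ξ
  have hIE : I ⊆ Eᶜ := connectedComponentIn_subset _ _
  have := ChartedSpace.locallyConnectedSpace (EuclideanSpace ℝ (Fin 1)) Circle
  have hIo : IsOpen I := hE.isOpen_compl.connectedComponentIn
  have hIc : IsPreconnected I := isPreconnected_connectedComponentIn
  have hξI : ξ ∈ I := mem_connectedComponentIn hξ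
  -- The branch of the angle with its cut at exp s₀. That point is in E, so f is continuous on I.
  set f : Circle → ℝ := fun z ↦
    Complex.arg (z * (Circle.exp (s₀ + Real.pi))⁻¹ : Circle) + (s₀ + Real.pi)
  have hexpf (z : Circle) : Circle.exp (f z) = z := by
    rw [Circle.exp_add, Circle.exp_arg, inv_mul_cancel_right]
  have hfexp {x : ℝ} (hx : x ∈ Set.Ioc s₀ (s₀ + 2 * Real.pi)) : f (Circle.exp x) = x := by
    simp only [f]
    rw [← Circle.exp_neg, ← Circle.exp_add, Circle.arg_exp] <;> linarith [hx.1, hx.2]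
  have hend : Circle.exp (s₀ + 2 * Real.pi) ∉ I := by
    rw [Circle.exp_add_two_pi]
    exact fun h ↦ hIE h hs
  have hfmem (z : Circle) : f z ∈ Set.Ioc s₀ (s₀ + 2 * Real.pi) := by
    have h1 := Complex.neg_pi_lt_arg (z * (Circle.exp (s₀ + Real.pi))⁻¹ : Circle)
    have h2 := Complex.arg_le_pi (z * (Circle.exp (s₀ + Real.pi))⁻¹ : Circle)
    constructor <;> simp only [f] <;> linarith
  have hJ : Circle.exp ⁻¹' I ∩ Set.Ioc s₀ (s₀ + 2 * Real.pi) = f '' I := by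
    ext x
    constructor
    · rintro ⟨h1, h2⟩
      exact ⟨_, h1, hfexp h2⟩
    · rintro ⟨z, hz, rfl⟩
      exact ⟨by rwa [Set.mem_preimage, hexpf], hfmem z⟩
  have hJ' : Circle.exp ⁻¹' I ∩ Set.Ioc s₀ (s₀ + 2 * Real.pi)
      = Circle.exp ⁻¹' I ∩ Set.Ioo s₀ (s₀ + 2 * Real.pi) := by
    ext x
    refine ⟨fun h ↦ ⟨h.1, h.2.1, lt_of_le_of_ne h.2.2 ?_⟩, fun h ↦ ⟨h.1, h.2.1, h.2.2.le⟩⟩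
    rintro rfl
    exact hend h.1
  have hcont : ContinuousOn f I := by
    intro z hz
    refine ContinuousAt.continuousWithinAt ?_
    refine ContinuousAt.add ?_ continuousAt_const
    refine ContinuousAt.comp (g := Complex.arg)
      (f := fun z : Circle ↦ ((z * (Circle.exp (s₀ + Real.pi))⁻¹ : Circle) : ℂ))
      (Complex.continuousAt_arg ?_) (by fun_prop)
    refine Complex.mem_slitPlane_iff_arg.2 ⟨fun h ↦ ?_, Circle.coe_ne_zero _⟩
    have h2 := hexpf z
    simp only [f] at h2
    rw [h, show Real.pi + (s₀ + Real.pi) = s₀ + 2 * Real.pi by ring] at h2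
    exact hend (h2 ▸ hz)
  have hconn : IsPreconnected (f '' I) := hIc.image f hcont
  have hopen : IsOpen (f '' I) := by
    rw [← hJ, hJ']
    exact (hIo.preimage Circle.exp.continuous).inter isOpen_Ioo
  have hne : (f '' I).Nonempty := ⟨_, ξ, hξI, rfl⟩
  have hsub : f '' I ⊆ Set.Ioc s₀ (s₀ + 2 * Real.pi) := hJ ▸ Set.inter_subset_right
  have hbb : BddBelow (f '' I) := bddBelow_Ioc.mono hsub
  have hba : BddAbove (f '' I) := bddAbove_Ioc.mono hsub
  have heq : f '' I = Set.Ioo (sInf (f '' I)) (sSup (f '' I)) := by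
    refine Set.Subset.antisymm (fun x hx ↦ ?_)
      (IsConnected.Ioo_csInf_csSup_subset ⟨hne, hconn⟩ hbb hba)
    obtain ⟨ε, hε, hball⟩ := Metric.isOpen_iff.1 hopen x hx
    have h1 : x - ε / 2 ∈ f '' I := hball (by
      rw [Metric.mem_ball, Real.dist_eq, abs_lt]; constructor <;> linarith)
    have h2 : x + ε / 2 ∈ f '' I := hball (by
      rw [Metric.mem_ball, Real.dist_eq, abs_lt]; constructor <;> linarith)
    exact ⟨by linarith [csInf_le hbb h1], by linarith [le_csSup hba h2]⟩
  refine ⟨_, _, ?_, hJ.trans heq⟩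
  obtain ⟨x, hx⟩ := hne
  rw [heq] at hx
  exact hx.1.trans hx.2

/-- The integrand is the majorant of log(2/d) on an arc with endpoints a and b. Its exact integral
produces the entropy term. -/
lemma integral_log_two_sided (a b : ℝ) :
    IntervalIntegrable (fun t ↦ Real.log Real.pi - Real.log (t - a) - Real.log (b - t)
      + Real.log (b - a)) volume a b ∧
    ∫ t in a..b, (Real.log Real.pi - Real.log (t - a) - Real.log (b - t) + Real.log (b - a))
      = (b - a) * (Real.log Real.pi + 2) + (b - a) * Real.log (1 / (b - a)) := by
  have i1 : IntervalIntegrable (fun t ↦ Real.log (t - a)) volume a b := by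
    simpa using (intervalIntegral.intervalIntegrable_log' (a := 0) (b := b - a)).comp_sub_right a
  have i2 : IntervalIntegrable (fun t ↦ Real.log (b - t)) volume a b := by
    simpa using ((intervalIntegral.intervalIntegrable_log' (a := b - a) (b := 0)).comp_sub_left b)
  have i0 (c : ℝ) : IntervalIntegrable (fun _ ↦ c) volume a b := intervalIntegrable_const
  refine ⟨(((i0 _).sub i1).sub i2).add (i0 _), ?_⟩
  rw [intervalIntegral.integral_add (((i0 _).sub i1).sub i2) (i0 _),
    intervalIntegral.integral_sub ((i0 _).sub i1) i2, intervalIntegral.integral_sub (i0 _) i1,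
    intervalIntegral.integral_comp_sub_right (fun t ↦ Real.log t),
    intervalIntegral.integral_comp_sub_left (fun t ↦ Real.log t)]
  simp only [intervalIntegral.integral_const, integral_log, sub_self, smul_eq_mul, zero_mul,
    one_div, Real.log_inv]
  ring

lemma lintegral_arc_le {E : Set Circle} (hE : IsClosed E) {s₀ : ℝ} (hs : Circle.exp s₀ ∈ E)
    {I : Set Circle} (hI : I ∈ complementaryArcs E) (hIm : MeasurableSet I) :
    ∫⁻ ζ in I, ENNReal.ofReal (Real.log (2 / distTo E ζ)) ∂arcLength
      ≤ ENNReal.ofReal (arcLength.real I * (Real.log Real.pi + 2)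
        + arcLength.real I * Real.log (1 / arcLength.real I)) := by
  obtain ⟨a, b, hab, hJ⟩ := exists_Ioo_of_mem_complementaryArcs hE hs hI
  have hIE : I ⊆ Eᶜ := by
    obtain ⟨ξ, -, rfl⟩ := hI
    exact connectedComponentIn_subset _ _
  have hout : ∀ s ∈ Set.Ioo a b, Circle.exp s ∉ E := fun s h ↦ hIE ((hJ ▸ h).1)
  have hlen : arcLength.real I = b - a := by
    rw [Measure.real, arcLength_apply s₀ hIm, hJ, Real.volume_Ioo,
      ENNReal.toReal_ofReal (by linarith)]
  have hexp := Circle.exp.continuous.measurable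
  have hmeas : Measurable fun ζ : Circle ↦ ENNReal.ofReal (Real.log (2 / distTo E ζ)) := by
    have := (continuous_distTo E).measurable
    have h2 : Measurable fun ζ : Circle ↦ (ζ : ℂ) := by fun_prop
    exact (Real.measurable_log.comp ((this.comp h2).const_div 2)).ennreal_ofReal
  rw [arcLength_eq_map s₀, setLIntegral_map hIm hmeas hexp, Measure.restrict_restrict (hexp hIm),
    hJ, ← arcLength_eq_map s₀, hlen, ← (integral_log_two_sided a b).2,
    intervalIntegral.integral_of_le hab.le, integral_Ioc_eq_integral_Ioo]
  -- Combines d ≥ (2/π) min(t - a, b - t) with min(t - a, b - t) ≥ (t - a)(b - t)/(b - a). The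
  -- product form separates the two endpoint singularities.
  have hle : ∀ t ∈ Set.Ioo a b, Real.log (2 / distTo E (Circle.exp t))
      ≤ Real.log Real.pi - Real.log (t - a) - Real.log (b - t) + Real.log (b - a) := by
    intro t ht
    have h1 : 0 < t - a := by linarith [ht.1]
    have h2 : 0 < b - t := by linarith [ht.2]
    have h3 : 0 < b - a := by linarith
    have h4 : 0 < distTo E (Circle.exp t) :=
      (distTo_coe_pos_iff hE ⟨_, hs⟩ _).2 (hout t ht)
    have h5 := mul_min_le_distTo ⟨_, hs⟩ hout t
    have h6 : (t - a) * (b - t) ≤ min (t - a) (b - t) * (b - a) := by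
      rcases le_total (t - a) (b - t) with h | h
      · rw [min_eq_left h]; gcongr; linarith
      · rw [min_eq_right h, mul_comm]; gcongr; linarith
    rw [← Real.log_div (by positivity) h1.ne', ← Real.log_div (by positivity) h2.ne',
      ← Real.log_mul (by positivity) h3.ne']
    refine Real.log_le_log (by positivity) ?_
    rw [div_div, div_mul_eq_mul_div, div_le_div_iff₀ h4 (by positivity)]
    have h7 : 2 * min (t - a) (b - t) ≤ Real.pi * distTo E (Circle.exp t) := by
      rw [div_mul_eq_mul_div, div_le_iff₀ Real.pi_pos] at h5
      linarith
    nlinarith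
  have hnn : ∀ t ∈ Set.Ioo a b, 0 ≤ Real.log (2 / distTo E (Circle.exp t)) := by
    intro t ht
    have h4 : 0 < distTo E (Circle.exp t) :=
      (distTo_coe_pos_iff hE ⟨_, hs⟩ _).2 (hout t ht)
    refine Real.log_nonneg ((one_le_div h4).2 (distTo_le_two ⟨_, hs⟩ (by simp)))
  rw [ofReal_integral_eq_lintegral_ofReal]
  · exact setLIntegral_mono' measurableSet_Ioo fun t ht ↦ ENNReal.ofReal_le_ofReal (hle t ht)
  · exact (integral_log_two_sided a b).1.1.mono_set Set.Ioo_subset_Ioc_self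
  · exact (ae_restrict_iff' measurableSet_Ioo).2
      (Eventually.of_forall fun t ht ↦ (hnn t ht).trans (hle t ht))

/-- The logarithm of the distance to a Beurling–Carleson set is integrable. -/
lemma lintegral_log_distTo_lt_top {E : Set Circle} (hE : IsBeurlingCarleson E)
    (hne : E.Nonempty) :
    ∫⁻ ζ : Circle, ENNReal.ofReal (Real.log (2 / distTo E ζ)) ∂arcLength < ⊤ := by
  obtain ⟨e, he⟩ := hne
  obtain ⟨s₀, rfl⟩ := Circle.exp_surjective e
  have := ChartedSpace.locallyConnectedSpace (EuclideanSpace ℝ (Fin 1)) Circle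
  have hopen : ∀ I ∈ complementaryArcs E, IsOpen I := by
    rintro _ ⟨ξ, -, rfl⟩
    exact hE.isClosed.isOpen_compl.connectedComponentIn
  have hnonempty : ∀ I ∈ complementaryArcs E, I.Nonempty := by
    rintro _ ⟨ξ, hξ, rfl⟩
    exact ⟨ξ, mem_connectedComponentIn hξ⟩
  have hdisj : (complementaryArcs E).PairwiseDisjoint id := by
    rintro _ ⟨ξ, hξ, rfl⟩ _ ⟨η, hη, rfl⟩ hne
    refine Set.disjoint_left.2 fun x hx hy ↦ hne ?_
    rw [connectedComponentIn_eq hx, connectedComponentIn_eq hy]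
  have hcount : (complementaryArcs E).Countable := hdisj.countable_of_isOpen hopen hnonempty
  have : Countable (complementaryArcs E) := hcount.to_subtype
  have hunion : Eᶜ = ⋃ I : complementaryArcs E, (I : Set Circle) := by
    ext ξ
    simp only [Set.mem_iUnion]
    constructor
    · exact fun hξ ↦ ⟨⟨_, ξ, hξ, rfl⟩, mem_connectedComponentIn hξ⟩
    · rintro ⟨⟨_, η, hη, rfl⟩, hx⟩
      exact connectedComponentIn_subset _ _ hx
  have hpair : Pairwise (Function.onFun Disjoint fun I : complementaryArcs E ↦ (I : Set Circle)) :=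
    hdisj.subtype _ _
  have hlen : Summable fun I : complementaryArcs E ↦ arcLength.real (I : Set Circle) := by
    refine ENNReal.summable_toReal ?_
    rw [← measure_iUnion hpair fun I ↦ (hopen I I.2).measurableSet]
    exact measure_ne_top _ _
  have hEc : arcLength.restrict Eᶜ = arcLength := by
    rw [Measure.restrict_eq_self_of_ae_mem]
    exact compl_mem_ae_iff.2 hE.null
  rw [← hEc, hunion, lintegral_iUnion (fun I : complementaryArcs E ↦ (hopen I I.2).measurableSet) hpair]
  refine (ENNReal.tsum_le_tsum fun I : complementaryArcs E ↦ lintegral_arc_le hE.isClosed he I.2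
    (hopen I I.2).measurableSet).trans_lt ?_
  exact ((hlen.mul_right _).add hE.entropy).tsum_ofReal_lt_top

/-! ### A measure with superlogarithmic density near E -/

/-- An integrable function admits an integrable majorant dominating each of its multiples on a
superlevel set. -/
lemma exists_superlinear_majorant {α : Type*} [MeasurableSpace α] {m : Measure α}
    {f : α → ENNReal} (hf : Measurable f) (hint : ∫⁻ x, f x ∂m ≠ ⊤) :
    ∃ g : α → ENNReal, Measurable g ∧ ∫⁻ x, g x ∂m ≠ ⊤ ∧
      ∀ N : ℕ, ∃ K : ENNReal, K ≠ ⊤ ∧ ∀ x, K < f x → N * f x ≤ g x := by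
  -- Levels whose tail integrals are summable; g is then the sum of the truncations of f above these
  -- levels.
  have htail : ∀ j : ℕ, ∃ K : ℕ, ∫⁻ x in {x | (K : ENNReal) < f x}, f x ∂m ≤ 2⁻¹ ^ j := by
    intro j
    obtain ⟨δ, hδ, h⟩ := exists_pos_setLIntegral_lt_of_measure_lt hint
      (ε := 2⁻¹ ^ j) (pow_ne_zero _ (by simp))
    obtain ⟨K, hK⟩ := ENNReal.exists_nat_gt (ENNReal.div_ne_top hint hδ.ne')
    have hle : m {x | (K : ENNReal) < f x} ≤ m {x | (K : ENNReal) ≤ f x} :=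
      measure_mono fun x hx ↦ by
        rw [Set.mem_ofPred_eq] at hx ⊢
        exact hx.le
    refine ⟨K, (h _ (hle.trans_lt (lt_of_le_of_lt (meas_ge_le_lintegral_div hf.aemeasurable
      (pos_of_gt hK).ne' (ENNReal.natCast_ne_top K)) ?_))).le⟩
    refine ENNReal.div_lt_of_lt_mul ?_
    rw [mul_comm]
    exact (ENNReal.div_lt_iff (.inl hδ.ne') (.inr hint)).1 hK
  choose K hK using htail
  have hms (j : ℕ) : MeasurableSet {x | (K j : ENNReal) < f x} :=
    measurableSet_lt measurable_const hf
  refine ⟨fun x ↦ ∑' j, {x | (K j : ENNReal) < f x}.indicator f x,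
    Measurable.tsum fun j ↦ hf.indicator (hms j), ?_, fun N ↦ ?_⟩
  · rw [lintegral_tsum fun j ↦ (hf.indicator (hms j)).aemeasurable]
    simp_rw [lintegral_indicator (hms _)]
    refine ((ENNReal.tsum_le_tsum hK).trans_lt ?_).ne
    rw [ENNReal.tsum_geometric]
    simp
  -- Above the first N levels, N terms of the series equal f x.
  · refine ⟨((Finset.range N).sup K : ℕ), ENNReal.natCast_ne_top _, fun x hx ↦ ?_⟩
    refine le_trans ?_ (ENNReal.sum_le_tsum (Finset.range N))
    rw [← nsmul_eq_mul]
    nth_rw 1 [← Finset.card_range N]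
    refine Finset.card_nsmul_le_sum _ _ _ fun j hj ↦ ?_
    rw [Set.indicator_of_mem]
    refine lt_of_le_of_lt ?_ hx
    exact_mod_cast Finset.le_sup (f := K) hj

/-- The measure has the superlinear majorant of log(2/d) as its density. The threshold r = exp(-K)
makes log(1/t), hence log(2/d) on A off E, exceed the level K. -/
lemma exists_measure_superlog {E : Set Circle} (hE : IsBeurlingCarleson E) (hne : E.Nonempty) :
    ∃ μ : Measure Circle, IsFiniteMeasure μ ∧ ∀ N : ℕ, ∃ r : ℝ, 0 < r ∧ r ≤ 1 ∧
      ∀ t : ℝ, 0 < t → t < r → ∀ A : Set Circle, MeasurableSet A →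
        (∀ ζ ∈ A, distTo E ζ ≤ t) →
          N * ENNReal.ofReal (Real.log (1 / t)) * arcLength A ≤ μ A := by
  have hmeas : Measurable fun ζ : Circle ↦ ENNReal.ofReal (Real.log (2 / distTo E ζ)) := by
    have := (continuous_distTo E).measurable
    have h2 : Measurable fun ζ : Circle ↦ (ζ : ℂ) := by fun_prop
    exact (Real.measurable_log.comp ((this.comp h2).const_div 2)).ennreal_ofReal
  obtain ⟨g, hg, hgint, hgN⟩ :=
    exists_superlinear_majorant hmeas (lintegral_log_distTo_lt_top hE hne).ne
  refine ⟨arcLength.withDensity g, isFiniteMeasure_withDensity hgint, fun N ↦ ?_⟩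
  obtain ⟨K, hK, hKg⟩ := hgN N
  refine ⟨Real.exp (-K.toReal), Real.exp_pos _,
    Real.exp_le_one_iff.2 (neg_nonpos.2 ENNReal.toReal_nonneg), fun t ht htr A hA hAt ↦ ?_⟩
  rw [withDensity_apply _ hA, ← setLIntegral_const]
  refine setLIntegral_mono_ae' hA ?_
  have hnull : ∀ᵐ ζ ∂arcLength, ζ ∉ E := compl_mem_ae_iff.2 hE.null
  filter_upwards [hnull] with ζ hζ hζA
  have hpos : 0 < distTo E ζ := (distTo_coe_pos_iff hE.isClosed hne ζ).2 hζ
  have hle : Real.log (1 / t) ≤ Real.log (2 / distTo E ζ) := by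
    have := hAt ζ hζA
    refine Real.log_le_log (by positivity) ?_
    gcongr
    norm_num
  have hlog : K.toReal < Real.log (1 / t) := by
    rw [one_div, Real.log_inv]
    have := Real.log_lt_log ht htr
    rw [Real.log_exp] at this
    linarith
  refine le_trans ?_ (hKg ζ ?_)
  · gcongr
  · rw [← ENNReal.ofReal_toReal hK]
    have := ENNReal.toReal_nonneg (a := K)
    exact (ENNReal.ofReal_lt_ofReal_iff (by linarith)).2 (by linarith)

/-! ### Poles outside the disc and growth of the real part -/

lemma one_sub_norm_le_distTo {E : Set Circle} (hne : E.Nonempty) (z : ℂ) :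
    1 - ‖z‖ ≤ distTo E z := by
  refine (Metric.le_infDist (hne.image _)).2 ?_
  rintro _ ⟨e, -, rfl⟩
  have := norm_sub_norm_le (e : ℂ) z
  rw [Circle.norm_coe, norm_sub_rev] at this
  rwa [dist_eq_norm]

/-- The point on the ray through `ζ` lying outside the unit disc at height `dist(ζ, E)`. -/
noncomputable def pole (E : Set Circle) (ζ : Circle) : ℂ := (1 + distTo E ζ : ℝ) * ζ

lemma measurable_pole (E : Set Circle) : Measurable (pole E) := by
  have := (continuous_distTo E)
  unfold pole
  fun_prop

lemma norm_pole (E : Set Circle) (ζ : Circle) : ‖pole E ζ‖ = 1 + distTo E ζ := by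
  have := distTo_nonneg E ζ
  rw [pole, norm_mul, Circle.norm_coe, mul_one, Complex.norm_of_nonneg (by linarith)]

lemma norm_pole_sub_coe (E : Set Circle) (ζ : Circle) : ‖pole E ζ - ζ‖ = distTo E ζ := by
  have := distTo_nonneg E ζ
  have h : pole E ζ - ζ = (distTo E ζ : ℂ) * ζ := by
    rw [pole]
    push_cast
    ring
  rw [h, norm_mul, Circle.norm_coe, mul_one, Complex.norm_of_nonneg this]

lemma norm_pole_le {E : Set Circle} (hne : E.Nonempty) (ζ : Circle) : ‖pole E ζ‖ ≤ 3 := by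
  rw [norm_pole]
  linarith [distTo_le_two hne (Circle.norm_coe ζ).le]

/-- Since |z| ≤ 1, the pole is at distance at least d(ζ) from z. Going from z to E through the pole
and then ζ costs |pole - z| + 2d(ζ), at most three times |pole - z|. -/
lemma distTo_le_norm_pole_sub (E : Set Circle) (ζ : Circle) {z : ℂ} (hz : ‖z‖ ≤ 1) :
    distTo E z / 3 ≤ ‖pole E ζ - z‖ := by
  have h1 := distTo_le_add E z ζ
  have h2 : ‖z - ζ‖ ≤ ‖z - pole E ζ‖ + ‖pole E ζ - ζ‖ := norm_sub_le_norm_sub_add_norm_sub _ _ _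
  have h3 := norm_sub_norm_le (pole E ζ) z
  rw [norm_pole] at h3
  rw [norm_pole_sub_coe, norm_sub_rev z (pole E ζ)] at h2
  linarith

section LowerBound

variable {E : Set Circle} {μ : Measure Circle} [IsFiniteMeasure μ]

lemma re_herglotz_pole (hne : E.Nonempty) {z : ℂ} (hz : ‖z‖ ≤ 1) (hd : 0 < distTo E z) :
    (herglotz μ (pole E) z).re = ∫ ζ, (‖pole E ζ‖ ^ 2 - ‖z‖ ^ 2) / ‖pole E ζ - z‖ ^ 2 ∂μ :=
  re_herglotz (measurable_pole E) (ae_of_all _ (norm_pole_le hne)) (m := distTo E z / 3)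
    (by linarith) (ae_of_all _ fun ζ ↦ distTo_le_norm_pole_sub E ζ hz)

lemma pole_kernel_nonneg (ζ : Circle) {z : ℂ} (hz : ‖z‖ ≤ 1) :
    0 ≤ (‖pole E ζ‖ ^ 2 - ‖z‖ ^ 2) / ‖pole E ζ - z‖ ^ 2 := by
  have h1 : 1 ≤ ‖pole E ζ‖ := by
    rw [norm_pole]
    linarith [distTo_nonneg E ζ]
  have : ‖z‖ ^ 2 ≤ ‖pole E ζ‖ ^ 2 := by gcongr; linarith
  have : 0 ≤ ‖pole E ζ‖ ^ 2 - ‖z‖ ^ 2 := by linarith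
  positivity

lemma re_herglotz_pole_nonneg (hne : E.Nonempty) {z : ℂ} (hz : ‖z‖ ≤ 1) (hd : 0 < distTo E z) :
    0 ≤ (herglotz μ (pole E) z).re := by
  rw [re_herglotz_pole hne hz hd]
  exact integral_nonneg fun ζ ↦ pole_kernel_nonneg ζ hz

/-- For ζ within d/4 of the radial projection ξ of z, the kernel has numerator at least 3d/4 and
denominator at most (4d)². The rest of the nonnegative kernel is discarded. -/
lemma mul_measure_le_re_herglotz_pole (hne : E.Nonempty) {z : ℂ} (hz : ‖z‖ ≤ 1)
    (hd : 0 < distTo E z) {ξ : Circle} (hξ : ‖z - ξ‖ = 1 - ‖z‖) :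
    3 / (64 * distTo E z) * μ.real {ζ : Circle | ‖(ζ : ℂ) - ξ‖ ≤ distTo E z / 4}
      ≤ (herglotz μ (pole E) z).re := by
  set d := distTo E z with hddef
  set A := {ζ : Circle | ‖(ζ : ℂ) - ξ‖ ≤ d / 4}
  have hA : MeasurableSet A := by measurability
  rw [re_herglotz_pole hne hz hd]
  have hbound (ζ : Circle) : ‖(‖pole E ζ‖ ^ 2 - ‖z‖ ^ 2) / ‖pole E ζ - z‖ ^ 2‖
      ≤ 9 / (d / 3) ^ 2 := by
    rw [Real.norm_of_nonneg (pole_kernel_nonneg ζ hz)]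
    have h1 := distTo_le_norm_pole_sub E ζ hz
    have h2 := norm_pole_le hne ζ
    have h3 : ‖pole E ζ‖ ^ 2 ≤ 3 ^ 2 := by gcongr
    gcongr
    nlinarith [sq_nonneg ‖z‖]
  have hint : Integrable (fun ζ ↦ (‖pole E ζ‖ ^ 2 - ‖z‖ ^ 2) / ‖pole E ζ - z‖ ^ 2) μ := by
    refine Integrable.of_bound ?_ _ (ae_of_all _ hbound)
    have := measurable_pole E
    exact Measurable.aestronglyMeasurable (by fun_prop)
  refine le_trans ?_ (setIntegral_le_integral (s := A) hint
    (ae_of_all _ fun ζ ↦ pole_kernel_nonneg ζ hz))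
  have hconst : 3 / (64 * d) * μ.real A = ∫ ζ in A, 3 / (64 * d) ∂μ := by
    rw [setIntegral_const, smul_eq_mul, mul_comm]
  rw [hconst]
  refine setIntegral_mono_on integrableOn_const hint.integrableOn hA fun ζ hζ ↦ ?_
  have hζ' : ‖(ζ : ℂ) - ξ‖ ≤ d / 4 := hζ
  have hzd : 1 - ‖z‖ ≤ d := one_sub_norm_le_distTo hne z
  have h1 : ‖(ζ : ℂ) - z‖ ≤ d / 4 + (1 - ‖z‖) := by
    have := norm_sub_le_norm_sub_add_norm_sub (ζ : ℂ) ξ z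
    rw [norm_sub_rev (ξ : ℂ), hξ] at this
    linarith
  have h2 : distTo E ζ ≤ d + ‖(ζ : ℂ) - z‖ := distTo_le_add E ζ z
  have h3 : d ≤ distTo E ζ + ‖(ζ : ℂ) - z‖ := by
    rw [norm_sub_rev]
    exact distTo_le_add E z ζ
  have h4 : ‖pole E ζ - z‖ ≤ 4 * d := by
    have := norm_sub_le_norm_sub_add_norm_sub (pole E ζ) ζ z
    rw [norm_pole_sub_coe] at this
    linarith
  have h5 : 0 < ‖pole E ζ - z‖ := by
    have := distTo_le_norm_pole_sub E ζ hz
    linarith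
  have h6 : 3 * d / 4 ≤ ‖pole E ζ‖ ^ 2 - ‖z‖ ^ 2 := by
    have e1 : 3 * d / 4 ≤ ‖pole E ζ‖ - ‖z‖ := by
      rw [norm_pole]
      linarith
    have e2 : 1 ≤ ‖pole E ζ‖ := by
      rw [norm_pole]
      linarith [distTo_nonneg E ζ]
    nlinarith [norm_nonneg z]
  calc 3 / (64 * d) = (3 * d / 4) / (4 * d) ^ 2 := by field_simp; norm_num
    _ ≤ _ := by gcongr; linarith

lemma exists_circle_norm_sub (z : ℂ) (hz : ‖z‖ ≤ 1) : ∃ ξ : Circle, ‖z - ξ‖ = 1 - ‖z‖ := by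
  refine ⟨Circle.exp z.arg, ?_⟩
  have h : z - Circle.exp z.arg = ((‖z‖ - 1 : ℝ) : ℂ) * Circle.exp z.arg := by
    nth_rw 1 [← Complex.norm_mul_exp_arg_mul_I z]
    rw [Circle.coe_exp]
    push_cast
    ring
  rw [h, norm_mul, Circle.norm_coe, mul_one, Complex.norm_real, Real.norm_eq_abs,
    abs_of_nonpos (by linarith), neg_sub]

/-- Superlogarithmic growth of the Herglotz-type integral at `E`. -/
lemma log_le_re_herglotz_pole (hne : E.Nonempty)
    (hμ : ∀ N : ℕ, ∃ r : ℝ, 0 < r ∧ r ≤ 1 ∧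
      ∀ t : ℝ, 0 < t → t < r → ∀ A : Set Circle, MeasurableSet A →
        (∀ ζ ∈ A, distTo E ζ ≤ t) →
          N * ENNReal.ofReal (Real.log (1 / t)) * arcLength A ≤ μ A) (N : ℕ) :
    ∃ C : ℝ, ∀ z : ℂ, ‖z‖ ≤ 1 → 0 < distTo E z →
      N * Real.log (2 / distTo E z) ≤ (herglotz μ (pole E) z).re + C := by
  -- The factor (3/(64d)) · 2(d/4) = 3/128 is lost below; 43 is the least integer that compensates.
  obtain ⟨r, hr, hr1, hrμ⟩ := hμ (43 * N)
  have hr2 : 1 ≤ 9 / (4 * r) := by rw [le_div_iff₀] <;> linarith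
  refine ⟨N * (Real.log (2 * (9 / 4)) + Real.log (9 / (4 * r))), fun z hz hd ↦ ?_⟩
  set d := distTo E z with hddef
  have hNn : (0 : ℝ) ≤ N := N.cast_nonneg
  have hl1 : 0 ≤ Real.log (2 * (9 / 4)) := Real.log_nonneg (by norm_num)
  have hl2 : 0 ≤ Real.log (9 / (4 * r)) := Real.log_nonneg hr2
  have hsplit : Real.log (2 / d) = Real.log (2 * (9 / 4)) + Real.log (1 / (9 * d / 4)) := by
    rw [← Real.log_mul (by norm_num) (by positivity)]
    congr 1
    field_simp
  rw [hsplit]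
  by_cases h : 9 * d / 4 < r
  · obtain ⟨ξ, hξ⟩ := exists_circle_norm_sub z hz
    have h1 := mul_measure_le_re_herglotz_pole (μ := μ) hne hz hd hξ
    set A := {ζ : Circle | ‖(ζ : ℂ) - ξ‖ ≤ d / 4} with hAdef
    have hA : MeasurableSet A := by measurability
    -- |ζ - z| ≤ d/4 + (1 - |z|) ≤ 5d/4, whence 9/4.
    have hAt : ∀ ζ ∈ A, distTo E ζ ≤ 9 * d / 4 := by
      intro ζ hζ
      have hζ' : ‖(ζ : ℂ) - ξ‖ ≤ d / 4 := hζ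
      have e1 := norm_sub_le_norm_sub_add_norm_sub (ζ : ℂ) ξ z
      rw [norm_sub_rev (ξ : ℂ), hξ] at e1
      have e2 := distTo_le_add E ζ z
      have hzd : 1 - ‖z‖ ≤ d := one_sub_norm_le_distTo hne z
      linarith
    have h2 := hrμ (9 * d / 4) (by linarith) h A hA hAt
    have h3 := two_mul_le_arcLength (h := d / 4) (by linarith) ξ
    have hlog : 0 ≤ Real.log (1 / (9 * d / 4)) :=
      Real.log_nonneg ((one_le_div (by linarith)).2 (by linarith))
    have h4 : ENNReal.ofReal ((43 * N : ℕ) * Real.log (1 / (9 * d / 4)) * (2 * (d / 4)))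
        ≤ μ A := by
      refine le_trans ?_ h2
      rw [ENNReal.ofReal_mul (by positivity), ENNReal.ofReal_mul (by positivity),
        ENNReal.ofReal_natCast]
      gcongr
    have h5 := (ENNReal.ofReal_le_iff_le_toReal (measure_ne_top μ A)).1 h4
    have h6 : N * Real.log (1 / (9 * d / 4)) ≤ 3 / (64 * d) * μ.real A := by
      calc N * Real.log (1 / (9 * d / 4))
          ≤ 129 / 128 * (N * Real.log (1 / (9 * d / 4))) := by
            have : 0 ≤ N * Real.log (1 / (9 * d / 4)) := by positivity
            linarith
        _ = 3 / (64 * d) * ((43 * N : ℕ) * Real.log (1 / (9 * d / 4)) * (2 * (d / 4))) := by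
            push_cast
            field_simp
            ring
        _ ≤ _ := by gcongr; exact h5
    nlinarith [mul_nonneg hNn hl2]
  -- Away from E the logarithm is bounded, and Re G ≥ 0 suffices.
  · have h1 := re_herglotz_pole_nonneg (μ := μ) hne hz hd
    have h2 : Real.log (1 / (9 * d / 4)) ≤ Real.log (9 / (4 * r)) := by
      refine Real.log_le_log (by positivity) ?_
      rw [div_le_div_iff₀ (by positivity) (by positivity)]
      linarith
    have : N * (Real.log (2 * (9 / 4)) + Real.log (1 / (9 * d / 4)))
      ≤ N * (Real.log (2 * (9 / 4)) + Real.log (9 / (4 * r))) := by gcongr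
    linarith

lemma exp_neg_re_herglotz_pole_le (hne : E.Nonempty)
    (hμ : ∀ N : ℕ, ∃ r : ℝ, 0 < r ∧ r ≤ 1 ∧
      ∀ t : ℝ, 0 < t → t < r → ∀ A : Set Circle, MeasurableSet A →
        (∀ ζ ∈ A, distTo E ζ ≤ t) →
          N * ENNReal.ofReal (Real.log (1 / t)) * arcLength A ≤ μ A)
    {ε : ℝ} (hε : 0 < ε) (N : ℕ) :
    ∃ C : ℝ, 0 ≤ C ∧ ∀ z : ℂ, ‖z‖ ≤ 1 → 0 < distTo E z →
      Real.exp (-(ε * (herglotz μ (pole E) z).re)) ≤ C * distTo E z ^ N := by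
  -- Growth of Re G at rate M > N/ε survives multiplication by ε.
  obtain ⟨M, hM⟩ := exists_nat_gt (N / ε)
  obtain ⟨C, hC⟩ := log_le_re_herglotz_pole hne hμ M
  refine ⟨Real.exp (ε * C), (Real.exp_pos _).le, fun z hz hd ↦ ?_⟩
  have h1 := hC z hz hd
  set d := distTo E z
  have hlog : 0 ≤ Real.log (2 / d) := Real.log_nonneg ((one_le_div hd).2 (distTo_le_two hne hz))
  rw [div_lt_iff₀ hε] at hM
  have h2 : N * Real.log (2 / d) ≤ ε * (herglotz μ (pole E) z).re + ε * C := by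
    calc N * Real.log (2 / d) ≤ M * ε * Real.log (2 / d) := by gcongr
      _ = ε * (M * Real.log (2 / d)) := by ring
      _ ≤ ε * ((herglotz μ (pole E) z).re + C) := by gcongr
      _ = _ := by ring
  calc Real.exp (-(ε * (herglotz μ (pole E) z).re))
      ≤ Real.exp (ε * C - N * Real.log (2 / d)) := by gcongr; linarith
    _ = Real.exp (ε * C) * (d / 2) ^ N := by
      rw [Real.exp_sub, mul_comm (N : ℝ), Real.exp_mul (Real.log (2 / d)), Real.exp_log (by positivity),
        Real.rpow_natCast, div_eq_mul_inv, ← inv_pow, inv_div]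
    _ ≤ _ := by gcongr; linarith

end LowerBound

/-! ### Oscillation on discs of radius comparable to d² -/

/-- The poles `w ζ` stay away from points of the closed disc, in proportion to the distance
to `E`. -/
structure PolesAway (E : Set Circle) (μ : Measure Circle) (w : Circle → ℂ) : Prop where
  measurable : Measurable w
  norm_le : ∀ᵐ ζ ∂μ, ‖w ζ‖ ≤ 3
  le_norm_sub : ∀ᵐ ζ ∂μ, ∀ z : ℂ, ‖z‖ ≤ 1 → distTo E z / 3 ≤ ‖w ζ - z‖

lemma polesAway_pole {E : Set Circle} (hne : E.Nonempty) (μ : Measure Circle) :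
    PolesAway E μ (pole E) :=
  ⟨measurable_pole E, ae_of_all _ (norm_pole_le hne),
    ae_of_all _ fun ζ _ ↦ distTo_le_norm_pole_sub E ζ⟩

/-- The poles of the exponent of S_ν lie on E almost surely, so even the bound with d in place of
d/3 holds. -/
lemma polesAway_coe {E : Set Circle} {ν : Measure Circle} (hν : ν Eᶜ = 0) :
    PolesAway E ν (fun ζ ↦ (ζ : ℂ)) := by
  refine ⟨by fun_prop, ae_of_all _ fun ζ ↦ by rw [Circle.norm_coe]; norm_num, ?_⟩
  have : ∀ᵐ ζ ∂ν, ζ ∈ E := hν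
  filter_upwards [this] with ζ hζ z _
  have h1 := distTo_le hζ z
  have h2 := distTo_nonneg E z
  rw [norm_sub_rev] at h1
  linarith

section Oscillation

variable {E : Set Circle} {μ : Measure Circle} [IsFiniteMeasure μ] {w : Circle → ℂ}

lemma PolesAway.exists_oscillation (h : PolesAway E μ w) (hne : E.Nonempty) :
    ∃ η : ℝ, 0 < η ∧ η ≤ 1 / 12 ∧ ∀ z x : ℂ, ‖z‖ ≤ 1 → 0 < distTo E z →
      ‖x - z‖ ≤ η * distTo E z ^ 2 →
        DifferentiableAt ℂ (herglotz μ w) x ∧ ‖herglotz μ w x - herglotz μ w z‖ ≤ 1 / 2 := by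
  set M := μ.real Set.univ with hM
  have hM0 : 0 ≤ M := measureReal_nonneg
  -- The 12 keeps x within d/6 of z (as d ≤ 2), so the poles stay d/6 away. The Lipschitz constant
  -- is then 108M/d², and 216 = 2 · 108 gives oscillation at most 1/2.
  refine ⟨1 / (12 + 216 * M), by positivity, ?_, fun z x hz hd hx ↦ ?_⟩
  · gcongr
    linarith
  set d := distTo E z
  have hd2 : d ≤ 2 := distTo_le_two hne hz
  have hxd : ‖x - z‖ ≤ d / 6 := by
    calc ‖x - z‖ ≤ 1 / (12 + 216 * M) * d ^ 2 := hx
      _ ≤ 1 / 12 * d ^ 2 := by gcongr; linarith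
      _ ≤ d / 6 := by nlinarith
  have hz' : ∀ᵐ ζ ∂μ, d / 3 ≤ ‖w ζ - z‖ := by
    filter_upwards [h.le_norm_sub] with ζ hζ using hζ z hz
  have hx' : ∀ᵐ ζ ∂μ, d / 6 ≤ ‖w ζ - x‖ := by
    filter_upwards [hz'] with ζ hζ
    have := norm_sub_le_norm_sub_add_norm_sub (w ζ) x z
    linarith
  have hd6 : 0 < d / 6 := by positivity
  have hd3 : 0 < d / 3 := by positivity
  refine ⟨differentiableAt_herglotz h.measurable h.norm_le hd6 hx', ?_⟩
  calc _ ≤ 6 / (d / 3 * (d / 6)) * ‖x - z‖ * M :=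
        norm_herglotz_sub_le h.measurable h.norm_le hd3 hd6 hz' hx'
    _ ≤ 6 / (d / 3 * (d / 6)) * (1 / (12 + 216 * M) * d ^ 2) * M := by gcongr
    _ = 108 * M / (12 + 216 * M) := by field_simp; ring
    _ ≤ 1 / 2 := by
      rw [div_le_div_iff₀ (by positivity) (by positivity)]
      linarith

lemma PolesAway.analyticAt (h : PolesAway E μ w) (hne : E.Nonempty) {z : ℂ} (hz : ‖z‖ ≤ 1)
    (hd : 0 < distTo E z) : AnalyticAt ℂ (herglotz μ w) z := by
  obtain ⟨η, hη, -, hosc⟩ := h.exists_oscillation hne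
  refine Complex.analyticAt_iff_eventually_differentiableAt.2 ?_
  filter_upwards [Metric.closedBall_mem_nhds z (mul_pos hη (pow_pos hd 2))] with x hx
  exact (hosc z x hz hd (mem_closedBall_iff_norm.1 hx)).1

end Oscillation

/-! ### Holomorphic functions of the angle -/

lemma analyticAt_iteratedDeriv {f : ℂ → ℂ} {z : ℂ} (hf : AnalyticAt ℂ f z) (k : ℕ) :
    AnalyticAt ℂ (iteratedDeriv k f) z := by
  rw [iteratedDeriv_eq_iterate]
  exact hf.iterated_deriv k

/-- A function which vanishes on `Z`, and agrees off `Z` with a holomorphic function with all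
derivatives `O(dist(·, Z)²)`, is smooth. -/
lemma contDiff_of_flat_analytic {P : ℂ → ℂ} {f : ℝ → ℂ} {Z : Set ℝ} (hZ : IsClosed Z)
    (hfZ : ∀ t ∈ Z, f t = 0) (hfP : ∀ t ∉ Z, f t = P t) (hP : ∀ t : ℝ, t ∉ Z → AnalyticAt ℂ P t)
    (hb : ∀ k : ℕ, ∃ C : ℝ, ∀ t : ℝ, t ∉ Z → ∀ s ∈ Z, ‖iteratedDeriv k P t‖ ≤ C * |t - s| ^ 2) :
    ContDiff ℝ ((⊤ : ℕ∞) : WithTop ℕ∞) f := by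
  have hder (k : ℕ) : ∀ t ∉ Z, iteratedDeriv k f t = iteratedDeriv k P t ∧
      HasDerivAt (iteratedDeriv k f) (iteratedDeriv (k + 1) P t) t := by
    have aux (k : ℕ) (hk : ∀ t ∉ Z, iteratedDeriv k f t = iteratedDeriv k P t) :
        ∀ t ∉ Z, HasDerivAt (iteratedDeriv k f) (iteratedDeriv (k + 1) P t) t := by
      intro t ht
      have h1 : HasDerivAt (iteratedDeriv k P) (iteratedDeriv (k + 1) P t) (t : ℂ) := by
        rw [iteratedDeriv_succ]
        exact (analyticAt_iteratedDeriv (hP t ht) k).differentiableAt.hasDerivAt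
      refine h1.comp_ofReal.congr_of_eventuallyEq ?_
      filter_upwards [hZ.isOpen_compl.mem_nhds ht] with s hs using hk s hs
    have main (k : ℕ) : ∀ t ∉ Z, iteratedDeriv k f t = iteratedDeriv k P t := by
      induction k with
      | zero => simpa using hfP
      | succ k ih =>
        intro t ht
        rw [iteratedDeriv_succ]
        exact (aux k ih t ht).deriv
    exact fun t ht ↦ ⟨main k t ht, aux k (main k) t ht⟩
  refine contDiff_of_flat hfZ (fun t ht k ↦ (hder k t ht).2.differentiableAt) fun k ↦ ?_
  obtain ⟨C, hC⟩ := hb k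
  exact ⟨C, fun t ht s hs ↦ (hder k t ht).1 ▸ hC t ht s hs⟩

lemma norm_cexp_I_mul_sub_le {τ : ℂ} {t : ℝ} (h : ‖τ - t‖ ≤ 1) :
    ‖Complex.exp (τ * Complex.I) - Circle.exp t‖ ≤ 2 * ‖τ - t‖ := by
  have e : Complex.exp (τ * Complex.I) - Circle.exp t
      = Circle.exp t * (Complex.exp ((τ - t) * Complex.I) - 1) := by
    rw [mul_sub, mul_one, Circle.coe_exp, ← Complex.exp_add]
    congr 2
    ring
  have hn : ‖(τ - t) * Complex.I‖ = ‖τ - t‖ := by rw [norm_mul, Complex.norm_I, mul_one]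
  rw [e, norm_mul, Circle.norm_coe, one_mul, ← hn]
  exact Complex.norm_exp_sub_one_le (hn.trans_le h)

/-! ### The outer functions and the boundary product -/

/-- The outer function `exp (-ε G)`, with `G` the Herglotz-type integral of `μ` with poles off
the closed disc. -/
noncomputable def flatOuter (E : Set Circle) (μ : Measure Circle) (ε : ℝ) (z : ℂ) : ℂ :=
  Complex.exp (-(ε * herglotz μ (pole E) z))

/-- The holomorphic extension in the angle of the boundary values of `S_ν · conj (flatOuter)`. -/
noncomputable def boundaryExponent (E : Set Circle) (μ ν : Measure Circle) (ε : ℝ) (τ : ℂ) : ℂ :=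
  herglotz ν (fun ζ ↦ (ζ : ℂ)) (Complex.exp (τ * Complex.I)) + ε * (starRingEnd ℂ)
    (herglotz μ (pole E) (Complex.exp ((starRingEnd ℂ) τ * Complex.I)))

lemma boundaryExponent_ofReal (E : Set Circle) (μ ν : Measure Circle) (ε t : ℝ) :
    boundaryExponent E μ ν ε t
    = herglotz ν (fun ζ ↦ (ζ : ℂ)) (Circle.exp t)
      + ε * (starRingEnd ℂ) (herglotz μ (pole E) (Circle.exp t)) := by
  rw [boundaryExponent, Complex.conj_ofReal, Circle.coe_exp]

lemma exp_neg_boundaryExponent_ofReal (E : Set Circle) (μ ν : Measure Circle) (ε t : ℝ) :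
    Complex.exp (-boundaryExponent E μ ν ε t)
      = singularInner ν (Circle.exp t) * (starRingEnd ℂ) (flatOuter E μ ε (Circle.exp t)) := by
  rw [boundaryExponent_ofReal, flatOuter, ← Complex.exp_conj, neg_add, Complex.exp_add]
  simp only [map_neg, map_mul, Complex.conj_ofReal]
  rfl

lemma tendsto_flatOuter (E : Set Circle) (μ : Measure Circle) (z : ℂ) :
    Tendsto (fun n : ℕ ↦ flatOuter E μ (1 / ((n : ℝ) + 1)) z) atTop (𝓝 1) := by
  have h1 : Tendsto (fun n : ℕ ↦ ((1 / ((n : ℝ) + 1) : ℝ) : ℂ)) atTop (𝓝 ((0 : ℝ) : ℂ)) :=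
    (Complex.continuous_ofReal.tendsto 0).comp tendsto_one_div_add_atTop_nhds_zero_nat
  have h2 := ((h1.mul_const (herglotz μ (pole E) z)).neg).cexp
  rwa [Complex.ofReal_zero, zero_mul, neg_zero, Complex.exp_zero] at h2

section Construction

variable {E : Set Circle} {μ ν : Measure Circle} [IsFiniteMeasure μ] [IsFiniteMeasure ν]

/-- `exp (-Re G)` vanishes on `E` to infinite order, together with all its positive powers. -/
def DecaysAt (E : Set Circle) (μ : Measure Circle) : Prop :=
  ∀ ε : ℝ, 0 < ε → ∀ N : ℕ, ∃ C : ℝ, 0 ≤ C ∧ ∀ z : ℂ, ‖z‖ ≤ 1 → 0 < distTo E z →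
    Real.exp (-(ε * (herglotz μ (pole E) z).re)) ≤ C * distTo E z ^ N

lemma norm_flatOuter_le_one (hne : E.Nonempty) {ε : ℝ} (hε : 0 < ε) {z : ℂ}
    (hz : ‖z‖ ≤ 1) (hd : 0 < distTo E z) : ‖flatOuter E μ ε z‖ ≤ 1 := by
  rw [flatOuter, Complex.norm_exp, Complex.neg_re, Complex.re_ofReal_mul]
  have := re_herglotz_pole_nonneg (μ := μ) hne hz hd
  exact Real.exp_le_one_iff.2 (neg_nonpos.2 (by positivity))

lemma analyticAt_flatOuter (hne : E.Nonempty) (ε : ℝ) {z : ℂ} (hz : ‖z‖ ≤ 1)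
    (hd : 0 < distTo E z) : AnalyticAt ℂ (flatOuter E μ ε) z := by
  have := (polesAway_pole hne μ).analyticAt hne hz hd
  exact (analyticAt_const.mul this).neg.cexp

lemma norm_iteratedDeriv_flatOuter_le (hne : E.Nonempty) (hdec : DecaysAt E μ) {ε : ℝ}
    (hε : 0 < ε) (hε1 : ε ≤ 1) (k : ℕ) :
    ∃ C : ℝ, ∀ z : ℂ, ‖z‖ ≤ 1 → 0 < distTo E z →
      ‖iteratedDeriv k (flatOuter E μ ε) z‖ ≤ C * distTo E z := by
  obtain ⟨η, hη, -, hosc⟩ := (polesAway_pole hne μ).exists_oscillation hne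
  -- The Cauchy estimate loses d^(2k); the remaining factor d gives the limit 0 at E.
  obtain ⟨C, hC0, hC⟩ := hdec ε hε (2 * k + 1)
  refine ⟨k.factorial * Real.exp 1 * C / η ^ k, fun z hz hd ↦ ?_⟩
  have h1 := norm_iteratedDeriv_exp_neg_le (Q := fun x ↦ ε * herglotz μ (pole E) x) (z := z)
    (r := η * distTo E z ^ 2) (by positivity)
    (fun x hx ↦ (hosc z x hz hd (mem_closedBall_iff_norm.1 hx)).1.const_mul _)
    (fun x hx ↦ by
      rw [← mul_sub, norm_mul, Complex.norm_real, Real.norm_of_nonneg hε.le]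
      have := (hosc z x hz hd (mem_closedBall_iff_norm.1 hx)).2
      nlinarith [norm_nonneg (herglotz μ (pole E) x - herglotz μ (pole E) z)]) k
  refine h1.trans ?_
  rw [Complex.re_ofReal_mul, sub_eq_add_neg, Real.exp_add]
  calc _ ≤ k.factorial * (Real.exp 1 * (C * distTo E z ^ (2 * k + 1)))
        / (η * distTo E z ^ 2) ^ k := by gcongr; exact hC z hz hd
    _ = _ := by
      rw [mul_pow, ← pow_mul, pow_succ]
      field_simp

lemma memAInfty_flatOuter (hne : E.Nonempty) (hdec : DecaysAt E μ) {ε : ℝ}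
    (hε : 0 < ε) (hε1 : ε ≤ 1) : MemAInfty (flatOuter E μ ε) := by
  intro k _
  have hball {z : ℂ} (hz : z ∈ Metric.ball (0 : ℂ) 1) : ‖z‖ ≤ 1 ∧ 0 < distTo E z := by
    rw [mem_ball_zero_iff] at hz
    exact ⟨hz.le, by linarith [one_sub_norm_le_distTo hne z]⟩
  refine ⟨fun z hz ↦ (analyticAt_flatOuter hne ε (hball hz).1
    (hball hz).2).differentiableAt.differentiableWithinAt, ?_⟩
  classical
  obtain ⟨C, hC⟩ := norm_iteratedDeriv_flatOuter_le hne hdec hε hε1 k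
  set F : ℂ → ℂ := fun z ↦ if 0 < distTo E z then iteratedDeriv k (flatOuter E μ ε) z else 0
  refine ⟨F, fun z hz ↦ ?_, fun z hz ↦ if_pos (hball hz).2⟩
  rw [mem_closedBall_zero_iff] at hz
  by_cases hd : 0 < distTo E z
  · refine ContinuousAt.continuousWithinAt ?_
    refine (analyticAt_iteratedDeriv (analyticAt_flatOuter (μ := μ) hne ε hz hd) k).continuousAt.congr ?_
    filter_upwards [(continuous_distTo E).continuousAt.eventually_const_lt hd] with x hx
    exact (if_pos hx).symm
  · have hd0 : distTo E z = 0 := le_antisymm (not_lt.1 hd) (distTo_nonneg E z)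
    have hF0 : F z = 0 := if_neg hd
    rw [ContinuousWithinAt, hF0]
    have hlim : Tendsto (fun x ↦ |C| * distTo E x) (𝓝[Metric.closedBall 0 1] z) (𝓝 0) := by
      have := ((continuous_distTo E).tendsto z).const_mul |C|
      rw [hd0, mul_zero] at this
      exact this.mono_left nhdsWithin_le_nhds
    refine squeeze_zero_norm' ?_ hlim
    filter_upwards [self_mem_nhdsWithin] with x hx
    rw [mem_closedBall_zero_iff] at hx
    have h0 := distTo_nonneg E x
    by_cases hdx : 0 < distTo E x
    · simp only [F, if_pos hdx]
      exact (hC x hx hdx).trans (by gcongr; exact le_abs_self C)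
    · simp only [F, if_neg hdx, norm_zero]
      positivity

/-- The numerator |ζ|² - |ξ|² of the Poisson kernel vanishes. Hence |S_ν| = 1 on the circle off E,
and the decay of the outer factor is not spoiled. -/
lemma re_herglotz_coe_eq_zero (hν : ν Eᶜ = 0) {ξ : Circle} (hd : 0 < distTo E ξ) :
    (herglotz ν (fun ζ ↦ (ζ : ℂ)) ξ).re = 0 := by
  have h := polesAway_coe hν
  rw [re_herglotz h.measurable h.norm_le (m := distTo E ξ / 3) (by positivity)]
  · simp only [Circle.norm_coe, sub_self, zero_div, integral_zero]
  · filter_upwards [h.le_norm_sub] with ζ hζ using hζ ξ (Circle.norm_coe ξ).le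

lemma exists_oscillation_boundaryExponent (hne : E.Nonempty) (hν : ν Eᶜ = 0) {ε : ℝ}
    (hε : 0 < ε) (hε1 : ε ≤ 1) :
    ∃ η : ℝ, 0 < η ∧ ∀ t : ℝ, 0 < distTo E (Circle.exp t) →
      ∀ τ ∈ Metric.closedBall (t : ℂ) (η * distTo E (Circle.exp t) ^ 2),
        DifferentiableAt ℂ (boundaryExponent E μ ν ε) τ ∧
          ‖boundaryExponent E μ ν ε τ - boundaryExponent E μ ν ε t‖ ≤ 1 := by
  obtain ⟨η₁, hη₁, hη₁', hosc₁⟩ := (polesAway_pole hne μ).exists_oscillation hne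
  obtain ⟨η₂, hη₂, -, hosc₂⟩ := (polesAway_coe hν).exists_oscillation hne
  -- Halved because passing from the angle to the circle can double distances. Each of the two terms
  -- then oscillates by at most 1/2.
  refine ⟨min η₁ η₂ / 2, by positivity, fun t hd τ hτ ↦ ?_⟩
  rw [mem_closedBall_iff_norm] at hτ
  have hz := (Circle.norm_coe (Circle.exp t)).le
  set d := distTo E (Circle.exp t)
  have hd2 : d ≤ 2 := distTo_le_two hne hz
  have hτ1 : 2 * ‖τ - t‖ ≤ η₁ * d ^ 2 := by
    have : min η₁ η₂ / 2 * d ^ 2 ≤ η₁ / 2 * d ^ 2 := by gcongr; exact min_le_left _ _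
    linarith
  have hτ2 : 2 * ‖τ - t‖ ≤ η₂ * d ^ 2 := by
    have : min η₁ η₂ / 2 * d ^ 2 ≤ η₂ / 2 * d ^ 2 := by gcongr; exact min_le_right _ _
    linarith
  have hone : ‖τ - t‖ ≤ 1 := by
    have : η₁ * d ^ 2 ≤ 1 / 12 * 2 ^ 2 := by gcongr
    linarith
  have hconj : ‖(starRingEnd ℂ) τ - t‖ = ‖τ - t‖ := by
    rw [← Complex.conj_ofReal t, ← map_sub, RCLike.norm_conj]
    simp
  have hx1 := norm_cexp_I_mul_sub_le (hconj.trans_le hone)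
  rw [hconj] at hx1
  obtain ⟨hD1, hO1⟩ := hosc₁ _ _ hz hd (hx1.trans hτ1)
  obtain ⟨hD2, hO2⟩ := hosc₂ _ _ hz hd ((norm_cexp_I_mul_sub_le hone).trans hτ2)
  constructor
  · refine DifferentiableAt.add ?_ (DifferentiableAt.const_mul ?_ _)
    · exact DifferentiableAt.comp (g := herglotz ν fun ζ ↦ (ζ : ℂ)) τ hD2 (by fun_prop)
    · have : DifferentiableAt ℂ
          (fun x ↦ herglotz μ (pole E) (Complex.exp (x * Complex.I))) ((starRingEnd ℂ) τ) :=
        DifferentiableAt.comp (g := herglotz μ (pole E)) _ hD1 (by fun_prop)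
      simpa [Function.comp_def] using this.conj_conj
  · rw [boundaryExponent_ofReal, boundaryExponent, add_sub_add_comm, ← mul_sub, ← map_sub]
    refine (norm_add_le _ _).trans ?_
    rw [norm_mul, RCLike.norm_conj, Complex.norm_real, Real.norm_of_nonneg hε.le]
    nlinarith [norm_nonneg (herglotz μ (pole E)
      (Complex.exp ((starRingEnd ℂ) τ * Complex.I)) - herglotz μ (pole E) (Circle.exp t))]

open Classical in
/-- The boundary function of `S_ν · conj (flatOuter)`, extended by zero to `E`. -/
noncomputable def boundaryProduct (E : Set Circle) (μ ν : Measure Circle) (ε : ℝ)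
    (ζ : Circle) : ℂ :=
  if ζ ∈ E then 0 else singularInner ν ζ * (starRingEnd ℂ) (flatOuter E μ ε ζ)

lemma smoothOnCircle_boundaryProduct (hE : IsClosed E) (hne : E.Nonempty) (hν : ν Eᶜ = 0)
    (hdec : DecaysAt E μ) {ε : ℝ} (hε : 0 < ε) (hε1 : ε ≤ 1) :
    SmoothOnCircle (boundaryProduct E μ ν ε) := by
  obtain ⟨η, hη, hosc⟩ := exists_oscillation_boundaryExponent (μ := μ) hne hν hε hε1
  have hpos {t : ℝ} (ht : t ∉ Circle.exp ⁻¹' E) : 0 < distTo E (Circle.exp t) :=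
    (distTo_coe_pos_iff hE hne _).2 ht
  refine contDiff_of_flat_analytic (P := fun τ ↦ Complex.exp (-boundaryExponent E μ ν ε τ))
    (Z := Circle.exp ⁻¹' E) (hE.preimage Circle.exp.continuous) (fun t ht ↦ if_pos ht)
    (fun t ht ↦ ?_) (fun t ht ↦ ?_) fun k ↦ ?_
  · rw [exp_neg_boundaryExponent_ofReal]
    exact if_neg ht
  · refine Complex.analyticAt_iff_eventually_differentiableAt.2 ?_
    have hd := hpos ht
    filter_upwards [Metric.closedBall_mem_nhds (t : ℂ) (mul_pos hη (pow_pos hd 2))] with x hx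
    exact (hosc t hd x hx).1.neg.cexp
  -- After the loss of d^(2k), a factor d² remains, as flat gluing requires.
  · obtain ⟨C, hC0, hC⟩ := hdec ε hε (2 * k + 2)
    refine ⟨k.factorial * Real.exp 1 * C / η ^ k, fun t ht s hs ↦ ?_⟩
    have hd := hpos ht
    have hz := (Circle.norm_coe (Circle.exp t)).le
    have hds : distTo E (Circle.exp t) ≤ |t - s| := by
      refine (distTo_le hs _).trans ?_
      rw [norm_exp_sub_exp, Real.norm_eq_abs, abs_mul, abs_two]
      have : |Real.sin ((t - s) / 2)| ≤ |(t - s) / 2| := Real.abs_sin_le_abs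
      rw [abs_div, abs_two] at this
      linarith
    have h1 := norm_iteratedDeriv_exp_neg_le (mul_pos hη (pow_pos hd 2))
      (fun x hx ↦ (hosc t hd x hx).1) (fun x hx ↦ (hosc t hd x hx).2) k
    refine h1.trans ?_
    rw [boundaryExponent_ofReal, Complex.add_re, re_herglotz_coe_eq_zero hν hd, zero_add,
      Complex.re_ofReal_mul, Complex.conj_re, sub_eq_add_neg, Real.exp_add]
    calc _ ≤ k.factorial * (Real.exp 1 * (C * distTo E (Circle.exp t) ^ (2 * k + 2)))
          / (η * distTo E (Circle.exp t) ^ 2) ^ k := by gcongr; exact hC _ hz hd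
      _ = k.factorial * Real.exp 1 * C / η ^ k * distTo E (Circle.exp t) ^ 2 := by
        rw [mul_pow, ← pow_mul, pow_add]
        field_simp
      _ ≤ _ := by gcongr

lemma hasBoundaryFunction_of_continuousAt (hE : arcLength E = 0) {f : ℂ → ℂ} {u : Circle → ℂ}
    (h : ∀ ζ ∉ E, ContinuousAt f ζ ∧ f ζ = u ζ) : HasBoundaryFunction f u := by
  have hnull : ∀ᵐ ζ ∂arcLength, ζ ∉ E := compl_mem_ae_iff.2 hE
  filter_upwards [hnull] with ζ hζ M _
  rw [← (h ζ hζ).2]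
  exact (h ζ hζ).1.tendsto.mono_left nhdsWithin_le_nhds

end Construction

end ModelSpace

/-! ### Assembly -/

theorem mainTheorem4 (ν : MeasureTheory.Measure Circle) [MeasureTheory.IsFiniteMeasure ν]
    (E : Set Circle) (hE : ModelSpace.IsBeurlingCarleson E) (hν : ν Eᶜ = 0) :
    ∃ H : ℕ → ℂ → ℂ,
      (∀ n, ModelSpace.MemAInfty (H n)) ∧
      (∀ n, ∃ u : Circle → ℂ, ModelSpace.SmoothOnCircle u ∧
        ModelSpace.HasBoundaryFunction
          (fun z ↦ ModelSpace.singularInner ν z * (starRingEnd ℂ) (H n z)) u) ∧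
      (∃ b : ℕ → Circle → ℂ, (∀ n, ModelSpace.HasBoundaryFunction (H n) (b n)) ∧
        ∀ᵐ ζ ∂ModelSpace.arcLength,
          Filter.Tendsto (fun n ↦ b n ζ) Filter.atTop (nhds 1)) ∧
      (∃ C : ℝ, ∀ n, ∀ z ∈ Metric.ball (0 : ℂ) 1, ‖H n z‖ ≤ C) := by
  open ModelSpace in
  rcases E.eq_empty_or_nonempty with rfl | hne
  -- The distance to the empty set is 0 by convention, so this case is separate; here S_ν = 1.
  · have hν0 : ν = 0 := by simpa using hν
    subst hν0
    refine ⟨fun _ _ ↦ 1, fun _ n _ ↦ ⟨differentiableOn_const _, iteratedDeriv n fun _ ↦ 1,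
      (contDiff_const.continuous_iteratedDeriv n le_top).continuousOn, fun _ _ ↦ rfl⟩,
      fun _ ↦ ⟨fun _ ↦ 1, contDiff_const, ?_⟩, ⟨fun _ _ ↦ 1, fun _ ↦ ?_, ?_⟩, 1, by simp⟩
    · refine ae_of_all _ fun ζ M _ ↦ ?_
      simp only [singularInner, integral_zero_measure, neg_zero, Complex.exp_zero, map_one, mul_one]
      exact tendsto_const_nhds
    · exact ae_of_all _ fun ζ M _ ↦ tendsto_const_nhds
    · exact ae_of_all _ fun ζ ↦ tendsto_const_nhds
  obtain ⟨μ, hμfin, hμ⟩ := exists_measure_superlog hE hne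
  have hdec : DecaysAt E μ := fun ε hε N ↦ exp_neg_re_herglotz_pole_le hne hμ hε N
  have hε (n : ℕ) : (0 : ℝ) < 1 / ((n : ℝ) + 1) := by positivity
  have hε1 (n : ℕ) : 1 / ((n : ℝ) + 1) ≤ 1 := by
    rw [div_le_one (by positivity)]
    linarith [n.cast_nonneg (α := ℝ)]
  have hpos {ζ : Circle} (hζ : ζ ∉ E) : 0 < distTo E ζ :=
    (distTo_coe_pos_iff hE.isClosed hne ζ).2 hζ
  have hcont (n : ℕ) {ζ : Circle} (hζ : ζ ∉ E) :
      ContinuousAt (flatOuter E μ (1 / ((n : ℝ) + 1))) ζ :=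
    (analyticAt_flatOuter hne _ (Circle.norm_coe ζ).le (hpos hζ)).continuousAt
  have hS {ζ : Circle} (hζ : ζ ∉ E) : ContinuousAt (singularInner ν) ζ :=
    ((polesAway_coe hν).analyticAt hne (Circle.norm_coe ζ).le
      (hpos hζ)).continuousAt.neg.cexp
  -- All functions involved are continuous at each point of the circle off the null set E, so their
  -- boundary functions are their values there.
  refine ⟨fun n ↦ flatOuter E μ (1 / ((n : ℝ) + 1)),
    fun n ↦ memAInfty_flatOuter hne hdec (hε n) (hε1 n),
    fun n ↦ ⟨boundaryProduct E μ ν (1 / ((n : ℝ) + 1)),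
      smoothOnCircle_boundaryProduct hE.isClosed hne hν hdec (hε n) (hε1 n), ?_⟩,
    ⟨fun n ζ ↦ flatOuter E μ (1 / ((n : ℝ) + 1)) ζ, fun n ↦ ?_,
      ae_of_all _ fun ζ ↦ tendsto_flatOuter E μ _⟩, 1, fun n z hz ↦ ?_⟩
  · exact hasBoundaryFunction_of_continuousAt hE.null fun ζ hζ ↦
      ⟨(hS hζ).mul (Complex.continuous_conj.continuousAt.comp (hcont n hζ)), (if_neg hζ).symm⟩
  · exact hasBoundaryFunction_of_continuousAt hE.null fun ζ hζ ↦ ⟨hcont n hζ, rfl⟩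
  · rw [mem_ball_zero_iff] at hz
    exact norm_flatOuter_le_one hne (hε n) hz.le (by linarith [one_sub_norm_le_distTo hne z])
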